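/- Let $\mathscr A$ be an abelian category and let $(\mathscr X,\mathscr Y)$ be an admissible balanced pair of additive subcategories of $\mathscr A$ (full, closed under isomorphisms and finite direct sums), in the following sense. A complex $K$ is called $\mathscr X$-exact if $\mathrm{Hom}_{\mathscr A}(X,K)$ is acyclic for every $X\in\mathscr X$. A left $\mathscr X$-resolution of $M$ is an $\mathscr X$-exact complex $\cdots\to X_1\to X_0\to M\to 0$ with all $X_i\in\mathscr X$; a right $\mathscr Y$-coresolution of $N$ is a complex $0\to N\to Y^0\to Y^1\to\cdots$ with all $Y^i\in\mathscr Y$ that becomes acyclic under $\mathrm{Hom}_{\mathscr A}(-,Y)$ for every $Y\in\mathscr Y$. The pair $(\mathscr X,\mathscr Y)$ is balanced if $\mathscr X$ is contravariantly finite, $\mathscr Y$ is covariantly finite, every object has a left $\mathscr X$-resolution that becomes acyclic under $\mathrm{Hom}_{\mathscr A}(-,Y)$ for all $Y\in\mathscr Y$, and every object has a right $\mathscr Y$-coresolution that becomes acyclic under $\mathrm{Hom}_{\mathscr A}(X,-)$ for all $X\in\mathscr X$. It is admissible if every right $\mathscr X$-approximation is an epimorphism; every $\mathscr X$-exact complex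 is then exact. For objects $M,N$ let $\mathrm{Ext}^i_{\mathscr X}(M,N)=H^i(\mathrm{Hom}_{\mathscr A}(X_\bullet,N))$, where $X_\bullet\to M$ is a left $\mathscr X$-resolution. Write $\mathscr X\text{-}\dim M\le n$ if there is a left $\mathscr X$-resolution $0\to X_n\to\cdots\to X_0\to M\to 0$. Let $T$ be an object of $\mathscr A$ all of whose copowers $T^{(I)}$ ($I$ a set) exist. Let $\mathrm{Add}\,T$ be the class of direct summands of the objects $T^{(I)}$, and put - $T^{\mathscr X\perp}=\{M : \mathrm{Ext}^i_{\mathscr X}(T,M)=0 \text{ for all } i\ge 1\}$; - ${}_T\mathscr X=\{M :$ there is an $\mathscr X$-exact sequence $\cdots\to T_1\xrightarrow{f_1}T_0\xrightarrow{f_0}M\to 0$ with $T_i\in\mathrm{Add}\,T$ and $\mathrm{Im} f_i\in T^{\mathscr X\perp}$ for all $i\ge 0\}$; - $\mathrm{Pres}^n_{\mathscr X}T=\{L :$ there is an $\mathscr X$-exact sequence $T_n\to\cdots\to T_1\to L\to 0$ with $T_i\in\mathrm{Add}\,T$ for $1\le i\le n\}$, where exactness is not required at the leftmost term (so $\mathrm{Pres}^0_{\mathscr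 X}T$ consists of all objects). Let $n\ge 0$ be an integer. The object $T$ is called $n$-$\mathscr X$-tilting if (1) $\mathscr X\text{-}\dim T\le n$; (2) $\mathrm{Ext}^i_{\mathscr X}(T,T^{(I)})=0$ for all $i>0$ and all sets $I$; (3) for every $X\in\mathscr X$ there is an $\mathscr X$-exact sequence $0\to X\to T_0\to\cdots\to T_n\to 0$ with all $T_i\in\mathrm{Add}\,T$. **Proposition.** If $T$ is $n$-$\mathscr X$-tilting, then for every object $U$ of $\mathscr A$ the following are equivalent: (1) $U\in T^{\mathscr X\perp}$; (2) $U\in{}_T\mathscr X$; (3) $U\in\mathrm{Pres}^n_{\mathscr X}T$. -/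

import Mathlib

open CategoryTheory CategoryTheory.Limits

universe v u

noncomputable section

namespace RelativeTilting

variable {C : Type u} [Category.{v} C] [Abelian C]

/-- The complex `Hom(X, K)` of abelian groups. -/
def homFrom (X : C) {c : ComplexShape ℕ} (K : HomologicalComplex C c) :
    HomologicalComplex AddCommGrpCat.{v} c :=
  ((preadditiveCoyoneda.obj (Opposite.op X)).mapHomologicalComplex c).obj K

/-- The complex `Hom(K, Y)` of abelian groups, with the direction of the differentials reversed. -/
def homInto {c : ComplexShape ℕ} (K : HomologicalComplex C c) (Y : C) :
    HomologicalComplex AddCommGrpCat.{v} c.symm :=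
  ((preadditiveYoneda.obj Y).mapHomologicalComplex c.symm).obj K.op

/-- `K` is `𝒳`-exact (right `𝒳`-acyclic) at the spot `i`: for every `X ∈ 𝒳` the complex
`Hom(X, K)` is exact at the spot `i`. -/
def XExactAt (𝒳 : ObjectProperty C) {c : ComplexShape ℕ} (K : HomologicalComplex C c)
    (i : ℕ) : Prop :=
  ∀ X : C, 𝒳 X → (homFrom X K).ExactAt i

/-- `K` is `𝒳`-exact, i.e. (right) `𝒳`-acyclic: `Hom(X, K)` is acyclic for every `X ∈ 𝒳`. -/
def XExact (𝒳 : ObjectProperty C) {c : ComplexShape ℕ} (K : HomologicalComplex C c) : Prop :=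
  ∀ i, XExactAt 𝒳 K i

/-- `K` is left `𝒴`-acyclic: `Hom(K, Y)` is acyclic for every `Y ∈ 𝒴`. -/
def LeftAcyclic (𝒴 : ObjectProperty C) {c : ComplexShape ℕ} (K : HomologicalComplex C c) : Prop :=
  ∀ Y : C, 𝒴 Y → ∀ i, (homInto K Y).ExactAt i

/-- A morphism `f : X ⟶ M` is a right `𝒳`-approximation of `M`: `X ∈ 𝒳` and every morphism from an
object of `𝒳` to `M` factors through `f`. -/
structure IsRightApprox (𝒳 : ObjectProperty C) {X M : C} (f : X ⟶ M) : Prop where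
  mem : 𝒳 X
  surjective : ∀ X' : C, 𝒳 X' → Function.Surjective (fun g : X' ⟶ X => g ≫ f)

/-- A morphism `f : M ⟶ Y` is a left `𝒴`-approximation of `M`: `Y ∈ 𝒴` and every morphism from
`M` to an object of `𝒴` factors through `f`. -/
structure IsLeftApprox (𝒴 : ObjectProperty C) {M Y : C} (f : M ⟶ Y) : Prop where
  mem : 𝒴 Y
  surjective : ∀ Y' : C, 𝒴 Y' → Function.Surjective (fun g : Y ⟶ Y' => f ≫ g)

def ContravariantlyFinite (𝒳 : ObjectProperty C) : Prop :=
  ∀ M : C, ∃ (X : C) (f : X ⟶ M), IsRightApprox 𝒳 f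

def CovariantlyFinite (𝒴 : ObjectProperty C) : Prop :=
  ∀ M : C, ∃ (Y : C) (f : M ⟶ Y), IsLeftApprox 𝒴 f

/-- A left `𝒳`-resolution `⋯ ⟶ X₁ ⟶ X₀ ⟶ M ⟶ 0`: all `Xᵢ` lie in `𝒳` and the augmented complex
is `𝒳`-exact. -/
structure LeftResolution (𝒳 : ObjectProperty C) (M : C) where
  /-- the deleted resolution `⋯ ⟶ X₁ ⟶ X₀ ⟶ 0` -/
  complex : ChainComplex C ℕ
  /-- the augmentation `X₀ ⟶ M` -/
  ε : complex.X 0 ⟶ M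
  w : complex.d 1 0 ≫ ε = 0
  mem : ∀ i, 𝒳 (complex.X i)
  exact : XExact 𝒳 (complex.augment ε w)

/-- The augmented complex `⋯ ⟶ X₁ ⟶ X₀ ⟶ M ⟶ 0`, with `M` in degree `0` and `Xᵢ` in degree
`i + 1`. -/
def LeftResolution.augmented {𝒳 : ObjectProperty C} {M : C} (P : LeftResolution 𝒳 M) :
    ChainComplex C ℕ :=
  P.complex.augment P.ε P.w

/-- A right `𝒴`-coresolution `0 ⟶ N ⟶ Y⁰ ⟶ Y¹ ⟶ ⋯`: all `Yⁱ` lie in `𝒴` and the augmented complex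
is left `𝒴`-acyclic. -/
structure RightCoresolution (𝒴 : ObjectProperty C) (N : C) where
  /-- the deleted coresolution `0 ⟶ Y⁰ ⟶ Y¹ ⟶ ⋯` -/
  complex : CochainComplex C ℕ
  /-- the augmentation `N ⟶ Y⁰` -/
  η : N ⟶ complex.X 0
  w : η ≫ complex.d 0 1 = 0
  mem : ∀ i, 𝒴 (complex.X i)
  acyclic : LeftAcyclic 𝒴 (complex.augment η w)

/-- The augmented complex `0 ⟶ N ⟶ Y⁰ ⟶ Y¹ ⟶ ⋯`, with `N` in degree `0` and `Yⁱ` in degree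
`i + 1`. -/
def RightCoresolution.augmented {𝒴 : ObjectProperty C} {N : C} (Q : RightCoresolution 𝒴 N) :
    CochainComplex C ℕ :=
  Q.complex.augment Q.η Q.w

/-- `(𝒳, 𝒴)` is a balanced pair of additive subcategories (full, closed under isomorphisms and
finite direct sums) of the abelian category `C`. -/
structure IsBalancedPair (𝒳 𝒴 : ObjectProperty C) : Prop where
  additive_left : 𝒳.IsClosedUnderFiniteProducts
  iso_left : 𝒳.IsClosedUnderIsomorphisms
  additive_right : 𝒴.IsClosedUnderFiniteProducts
  iso_right : 𝒴.IsClosedUnderIsomorphisms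
  contravariantlyFinite : ContravariantlyFinite 𝒳
  covariantlyFinite : CovariantlyFinite 𝒴
  resolution : ∀ M : C, ∃ P : LeftResolution 𝒳 M, LeftAcyclic 𝒴 P.augmented
  coresolution : ∀ N : C, ∃ Q : RightCoresolution 𝒴 N, XExact 𝒳 Q.augmented

/-- The balanced pair `(𝒳, 𝒴)` is admissible: every right `𝒳`-approximation is an epimorphism.
In that case every `𝒳`-exact complex is exact. -/
structure IsAdmissibleBalancedPair (𝒳 𝒴 : ObjectProperty C) : Prop
    extends IsBalancedPair 𝒳 𝒴 where
  admissible : ∀ {X M : C} (f : X ⟶ M), IsRightApprox 𝒳 f → Epi f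

section Ext

variable {𝒳 𝒴 : ObjectProperty C}

/-- A chosen left `𝒳`-resolution of `M`. -/
def IsBalancedPair.chosenResolution (h : IsBalancedPair 𝒳 𝒴) (M : C) : LeftResolution 𝒳 M :=
  (h.resolution M).choose

/-- The relative extension group `Ext^i_𝒳(M, N)`: the `i`-th cohomology of `Hom(X_•, N)`, where
`X_• ⟶ M` is a left `𝒳`-resolution. -/
def relExt (h : IsBalancedPair 𝒳 𝒴) (M N : C) (i : ℕ) : AddCommGrpCat.{v} :=
  (homInto (h.chosenResolution M).complex N).homology i

/-- The class `T^{𝒳⊥}` of all `M` with `Ext^i_𝒳(T, M) = 0` for all `i ≥ 1`. -/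
def rightPerp (h : IsBalancedPair 𝒳 𝒴) (T : C) : ObjectProperty C := fun M =>
  ∀ i : ℕ, 1 ≤ i → IsZero (relExt h T M i)

end Ext

/-- The left `𝒳`-dimension of `M` is at most `n`: there is a left `𝒳`-resolution
`0 ⟶ Xₙ ⟶ ⋯ ⟶ X₀ ⟶ M ⟶ 0`. -/
def XDimLE (𝒳 : ObjectProperty C) (M : C) (n : ℕ) : Prop :=
  ∃ P : LeftResolution 𝒳 M, ∀ i : ℕ, n < i → IsZero (P.complex.X i)

section Add

variable (T : C) [∀ I : Type v, HasCoproduct fun _ : I => T]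

/-- The copower `T^(I)`: the direct sum of copies of `T` indexed by `I`. -/
def copower (I : Type v) : C := ∐ fun _ : I => T

/-- `Add T`: the direct summands of direct sums of copies of `T`. -/
def addClosure : ObjectProperty C := fun K =>
  ∃ (J : C) (I : Type v), Nonempty (K ⊞ J ≅ copower T I)

/-- The class `Pres^n_𝒳 T` of all `L` for which there is an `𝒳`-exact sequence
`Tₙ ⟶ ⋯ ⟶ T₁ ⟶ L ⟶ 0` with all `Tⱼ ∈ Add T`. In the augmented complex below, `L` sits in degree `0`
and `Tⱼ` in degree `j`; the sequence has to be exact everywhere except at its leftmost term, and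
the terms in degrees `> n` play no role. (For `n = 0` the sequence is `L ⟶ 0` with leftmost term
`L`, and there is no condition.) -/
def Pres (𝒳 : ObjectProperty C) (n : ℕ) : ObjectProperty C := fun L =>
  ∃ (P : ChainComplex C ℕ) (ε : P.X 0 ⟶ L) (w : P.d 1 0 ≫ ε = 0),
    (∀ i : ℕ, i < n → addClosure T (P.X i)) ∧
    (∀ i : ℕ, i < n → XExactAt 𝒳 (P.augment ε w) i)

variable {𝒳 𝒴 : ObjectProperty C}

/-- The class `_T𝒳` of all `M` for which there is an `𝒳`-exact sequence
`⋯ ⟶ T₁ ⟶ T₀ ⟶ M ⟶ 0` with all `Tᵢ ∈ Add T`, such that the image of each of its maps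
`fᵢ : Tᵢ ⟶ Tᵢ₋₁` (`T₋₁ = M`) lies in `T^{𝒳⊥}`. -/
def leftClass (h : IsBalancedPair 𝒳 𝒴) : ObjectProperty C := fun M =>
  ∃ (P : ChainComplex C ℕ) (ε : P.X 0 ⟶ M) (w : P.d 1 0 ≫ ε = 0),
    (∀ i : ℕ, addClosure T (P.X i)) ∧
    XExact 𝒳 (P.augment ε w) ∧
    (∀ i : ℕ, rightPerp h T (image ((P.augment ε w).d (i + 1) i)))

/-- `T` is `n`-`𝒳`-tilting with respect to the balanced pair `(𝒳, 𝒴)`. -/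
structure IsTilting (h : IsBalancedPair 𝒳 𝒴) (n : ℕ) : Prop where
  dim_le : XDimLE 𝒳 T n
  selfOrthogonal : ∀ (I : Type v) (i : ℕ), 0 < i → IsZero (relExt h T (copower T I) i)
  /-- for each `X ∈ 𝒳` there is an `𝒳`-exact sequence `0 ⟶ X ⟶ T⁰ ⟶ ⋯ ⟶ Tⁿ ⟶ 0` with all
  `Tⁱ ∈ Add T` -/
  coresolution : ∀ X : C, 𝒳 X →
    ∃ (Q : CochainComplex C ℕ) (η : X ⟶ Q.X 0) (w : η ≫ Q.d 0 1 = 0),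
      (∀ i : ℕ, i ≤ n → addClosure T (Q.X i)) ∧
      (∀ i : ℕ, n < i → IsZero (Q.X i)) ∧
      XExact 𝒳 (Q.augment η w)

end Add

end RelativeTilting

end

/-! Only the vanishing of Ext matters, so no connecting maps are built. `ExtVanish 𝒳 𝒴 k A M`
encodes Ext^{k+1}(A, M) = 0 as a lifting property against conflations, after passing to k-th
cosyzygies of M. Balance (`exists_extension`, `extOneVanish_syzygy_iff_cosyzygy`) lets syzygies of A
do the same work, and `isZero_relExt_iff` ties the notion to homology.

(1) ⇒ (2): the third tilting axiom embeds X ∈ 𝒳 into an object of Add T whose cokernel is left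
orthogonal to T^{𝒳⊥}. So for M ∈ T^{𝒳⊥} a map X ⟶ M extends to that object and then factors through
the evaluation T^(Hom(T, M)) ⟶ M, which is therefore a deflation. Its kernel stays in T^{𝒳⊥}: all
maps T ⟶ M lift, which kills Ext^1, and higher degrees shift to M. Iterate and splice.

(2) ⇒ (3) is truncation. (3) ⇒ (1): as Ext^i(T, Add T) = 0 for i ≥ 1, shifting reduces Ext^i(T, L)
to Ext^{i+n}(T, -) of the n-th syzygy, which vanishes since 𝒳-dim T ≤ n. -/

namespace RelativeTilting

/-! ### The evaluation map from a copower of T -/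

section Evaluation

variable {C : Type u} [Category.{v} C] (T : C) [∀ I : Type v, HasCoproduct fun _ : I => T]

/-- The canonical map `T^(Hom(T, M)) ⟶ M`. -/
noncomputable def evaluation (M : C) : copower T (T ⟶ M) ⟶ M := Sigma.desc fun f => f

theorem exists_lift_evaluation {M : C} (f : T ⟶ M) :
    ∃ g : T ⟶ copower T (T ⟶ M), g ≫ evaluation T M = f :=
  ⟨Sigma.ι (fun _ : T ⟶ M => T) f, Sigma.ι_desc _ _⟩

theorem exists_lift_evaluation_of_copower {M : C} {I : Type v} (f : copower T I ⟶ M) :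
    ∃ g : copower T I ⟶ copower T (T ⟶ M), g ≫ evaluation T M = f := by
  choose g hg using fun a : I =>
    exists_lift_evaluation T (Sigma.ι (fun _ : I => T) a ≫ (show (∐ fun _ : I => T) ⟶ M from f))
  exact ⟨Sigma.desc g, Sigma.hom_ext (f := fun _ : I => T) _ _ fun a =>
    (Sigma.ι_desc_assoc _ _ _).trans (hg a)⟩

end Evaluation

variable {C : Type u} [Category.{v} C] [Abelian C] {𝒳 𝒴 : ObjectProperty C}

/-! ### Relative exactness in terms of morphisms -/

section Exactness

/-- Exactness of `Hom(X, K)` at `j`, in terms of morphisms. -/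
theorem homFrom_exactAt_iff {c : ComplexShape ℕ} (K : HomologicalComplex C c) (X : C)
    {i j k : ℕ} (hi : c.prev j = i) (hk : c.next j = k) :
    (homFrom X K).ExactAt j ↔
      ∀ f : X ⟶ K.X j, f ≫ K.d j k = 0 → ∃ g : X ⟶ K.X i, g ≫ K.d i j = f := by
  rw [HomologicalComplex.exactAt_iff' _ i j k hi hk, ShortComplex.ab_exact_iff]
  rfl

/-- Exactness of `Hom(K, Y)` at `j`, in terms of morphisms. -/
theorem homInto_exactAt_iff {c : ComplexShape ℕ} (K : HomologicalComplex C c) (Y : C)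
    {i j k : ℕ} (hi : c.symm.prev j = i) (hk : c.symm.next j = k) :
    (homInto K Y).ExactAt j ↔
      ∀ f : K.X j ⟶ Y, K.d k j ≫ f = 0 → ∃ g : K.X i ⟶ Y, K.d j i ≫ g = f := by
  rw [HomologicalComplex.exactAt_iff' _ i j k hi hk, ShortComplex.ab_exact_iff]
  rfl

theorem homInto_exactAt_succ_iff (K : ChainComplex C ℕ) (Y : C) (i : ℕ) :
    (homInto K Y).ExactAt (i + 1) ↔
      ∀ f : K.X (i + 1) ⟶ Y, K.d (i + 2) (i + 1) ≫ f = 0 →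
        ∃ g : K.X i ⟶ Y, K.d (i + 1) i ≫ g = f :=
  homInto_exactAt_iff K Y
    (ComplexShape.prev_eq' (ComplexShape.down ℕ).symm rfl)
    (ComplexShape.next_eq' (ComplexShape.down ℕ).symm rfl)

theorem xExactAt_chain_zero_iff (K : ChainComplex C ℕ) :
    XExactAt 𝒳 K 0 ↔ ∀ X, 𝒳 X → ∀ f : X ⟶ K.X 0, ∃ g : X ⟶ K.X 1, g ≫ K.d 1 0 = f := by
  have hp : (ComplexShape.down ℕ).prev 0 = 1 := by simp
  -- Nothing follows degree 0, so `next` takes its default value and `d 0 0` is zero: the cycle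
  -- condition is void.
  have hn : (ComplexShape.down ℕ).next 0 = 0 := by simp
  refine forall₂_congr fun X _ => ?_
  rw [homFrom_exactAt_iff K X hp hn]
  refine forall_congr' fun f => ?_
  simp

theorem xExactAt_chain_succ_iff (K : ChainComplex C ℕ) (j : ℕ) :
    XExactAt 𝒳 K (j + 1) ↔ ∀ X, 𝒳 X → ∀ f : X ⟶ K.X (j + 1), f ≫ K.d (j + 1) j = 0 →
      ∃ g : X ⟶ K.X (j + 2), g ≫ K.d (j + 2) (j + 1) = f :=
  forall₂_congr fun X _ => homFrom_exactAt_iff K X (by simp) (by simp)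

theorem xExactAt_cochain_zero_iff (K : CochainComplex C ℕ) :
    XExactAt 𝒳 K 0 ↔ ∀ X, 𝒳 X → ∀ f : X ⟶ K.X 0, f ≫ K.d 0 1 = 0 → f = 0 := by
  have hp : (ComplexShape.up ℕ).prev 0 = 0 := by simp
  have hn : (ComplexShape.up ℕ).next 0 = 1 := by simp
  refine forall₂_congr fun X _ => ?_
  rw [homFrom_exactAt_iff K X hp hn]
  refine forall₂_congr fun f _ => ?_
  simp [eq_comm]

theorem xExactAt_cochain_succ_iff (K : CochainComplex C ℕ) (j : ℕ) :
    XExactAt 𝒳 K (j + 1) ↔ ∀ X, 𝒳 X → ∀ f : X ⟶ K.X (j + 1), f ≫ K.d (j + 1) (j + 2) = 0 →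
      ∃ g : X ⟶ K.X j, g ≫ K.d j (j + 1) = f :=
  forall₂_congr fun X _ => homFrom_exactAt_iff K X (by simp) (by simp)

end Exactness

/-! ### Conflations and admissibility -/

/-- A conflation `A ⟶ B ⟶ F` is an `𝒳`-exact short exact sequence `0 ⟶ A ⟶ B ⟶ F ⟶ 0`. -/
structure IsConflation (𝒳 : ObjectProperty C) {A B F : C} (i : A ⟶ B) (p : B ⟶ F) : Prop where
  zero : i ≫ p = 0
  mono : Mono i
  epi : Epi p
  exists_lift : ∀ {W : C} (k : W ⟶ B), k ≫ p = 0 → ∃ l : W ⟶ A, l ≫ i = k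
  lift_of_mem : ∀ X, 𝒳 X → ∀ f : X ⟶ F, ∃ g : X ⟶ B, g ≫ p = f

theorem IsConflation.exists_desc {A B F : C} {i : A ⟶ B} {p : B ⟶ F} (hc : IsConflation 𝒳 i p)
    {W : C} (k : B ⟶ W) (hk : i ≫ k = 0) : ∃ l : F ⟶ W, p ≫ l = k := by
  have := hc.epi
  obtain ⟨l, hl⟩ := hc.exists_lift (kernel.ι p) (kernel.condition p)
  exact ⟨Abelian.epiDesc p k (by rw [← hl, Category.assoc, hk, comp_zero]),
    Abelian.comp_epiDesc _ _ _⟩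

namespace IsAdmissibleBalancedPair

variable (h : IsAdmissibleBalancedPair 𝒳 𝒴)

include h

theorem exists_epi (M : C) : ∃ (X : C) (e : X ⟶ M), 𝒳 X ∧ Epi e := by
  obtain ⟨X, e, he⟩ := h.contravariantlyFinite M
  exact ⟨X, e, he.mem, h.admissible e he⟩

theorem epi_of_lift {B F : C} (p : B ⟶ F)
    (hp : ∀ X, 𝒳 X → ∀ f : X ⟶ F, ∃ g : X ⟶ B, g ≫ p = f) : Epi p := by
  obtain ⟨X, e, hX, he⟩ := h.exists_epi F
  obtain ⟨g, rfl⟩ := hp X hX e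
  exact epi_of_epi g p

theorem isConflation_kernel {B F : C} (p : B ⟶ F)
    (hp : ∀ X, 𝒳 X → ∀ f : X ⟶ F, ∃ g : X ⟶ B, g ≫ p = f) :
    IsConflation 𝒳 (kernel.ι p) p where
  zero := kernel.condition p
  mono := inferInstance
  epi := h.epi_of_lift p hp
  exists_lift k hk := ⟨kernel.lift p k hk, kernel.lift_ι _ _ _⟩
  lift_of_mem := hp

/-- Objects of 𝒳 suffice as test objects, because admissibility makes every W a quotient of one. A
lift found on the cover descends to W since `i` is mono. -/
theorem isConflation_of_exact {A B F : C} {i : A ⟶ B} {p : B ⟶ F} (zero : i ≫ p = 0)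
    (hA : ∀ X, 𝒳 X → ∀ f : X ⟶ A, f ≫ i = 0 → f = 0)
    (hB : ∀ X, 𝒳 X → ∀ f : X ⟶ B, f ≫ p = 0 → ∃ g : X ⟶ A, g ≫ i = f)
    (hF : ∀ X, 𝒳 X → ∀ f : X ⟶ F, ∃ g : X ⟶ B, g ≫ p = f) : IsConflation 𝒳 i p := by
  have hi : Mono i := by
    refine Preadditive.mono_of_cancel_zero i fun {W} f hf => ?_
    obtain ⟨X, e, hX, he⟩ := h.exists_epi W
    rw [← cancel_epi e, comp_zero]
    exact hA X hX _ (by rw [Category.assoc, hf, comp_zero])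
  refine ⟨zero, hi, h.epi_of_lift p hF, fun {W} k hk => ?_, hF⟩
  obtain ⟨X, e, hX, he⟩ := h.exists_epi W
  obtain ⟨g, hg⟩ := hB X hX (e ≫ k) (by rw [Category.assoc, hk, comp_zero])
  have hz : kernel.ι e ≫ g = 0 := by
    rw [← cancel_mono i, Category.assoc, hg, kernel.condition_assoc, zero_comp, zero_comp]
  refine ⟨Abelian.epiDesc e g hz, ?_⟩
  rw [← cancel_epi e, Abelian.comp_epiDesc_assoc, hg]

end IsAdmissibleBalancedPair

/-! ### Cutting complexes into conflations -/

section Syzygy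

/-- The syzygies of a chain complex `⋯ ⟶ K₁ ⟶ K₀`, with `K₀` as the zeroth one. -/
noncomputable def syzygy (K : ChainComplex C ℕ) : ℕ → C
  | 0 => K.X 0
  | j + 1 => kernel (K.d (j + 1) j)

/-- The inclusion of a syzygy. -/
noncomputable def syzygyι (K : ChainComplex C ℕ) (j : ℕ) : syzygy K (j + 1) ⟶ K.X (j + 1) :=
  kernel.ι (K.d (j + 1) j)

/-- The projection onto a syzygy. -/
noncomputable def syzygyπ (K : ChainComplex C ℕ) : ∀ j, K.X (j + 1) ⟶ syzygy K j
  | 0 => K.d 1 0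
  | j + 1 => kernel.lift (K.d (j + 1) j) (K.d (j + 2) (j + 1)) (K.d_comp_d _ _ _)

theorem syzygyπ_comp_ι (K : ChainComplex C ℕ) (j : ℕ) :
    syzygyπ K (j + 1) ≫ syzygyι K j = K.d (j + 2) (j + 1) :=
  kernel.lift_ι _ _ _

instance (K : ChainComplex C ℕ) (j : ℕ) : Mono (syzygyι K j) :=
  inferInstanceAs (Mono (kernel.ι (K.d (j + 1) j)))

theorem comp_syzygyπ_eq_zero_iff (K : ChainComplex C ℕ) (j : ℕ) {W : C} (f : W ⟶ K.X (j + 1)) :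
    f ≫ syzygyπ K j = 0 ↔ f ≫ K.d (j + 1) j = 0 := by
  cases j with
  | zero => rfl
  | succ j =>
    rw [← syzygyπ_comp_ι, ← Category.assoc]
    exact ⟨fun hf => by rw [hf, zero_comp], fun hf => zero_of_comp_mono _ hf⟩

/-- Exactness at the single spot `j` gives the lifting; the rest holds because the next syzygy is a
kernel. Hence the truncated sequences of `Pres` are covered. -/
theorem IsAdmissibleBalancedPair.isConflation_syzygy (h : IsAdmissibleBalancedPair 𝒳 𝒴)
    (K : ChainComplex C ℕ) (j : ℕ) (hK : XExactAt 𝒳 K j) :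
    IsConflation 𝒳 (syzygyι K j) (syzygyπ K j) := by
  have hlift : ∀ X, 𝒳 X → ∀ f : X ⟶ syzygy K j, ∃ g : X ⟶ K.X (j + 1), g ≫ syzygyπ K j = f := by
    intro X hX f
    cases j with
    | zero => exact (xExactAt_chain_zero_iff K).1 hK X hX f
    | succ j =>
      obtain ⟨g, hg⟩ := (xExactAt_chain_succ_iff K j).1 hK X hX (f ≫ syzygyι K j)
        (by rw [Category.assoc]; exact (congrArg _ (kernel.condition _)).trans comp_zero)
      refine ⟨g, ?_⟩
      rw [← cancel_mono (syzygyι K j), Category.assoc, syzygyπ_comp_ι, hg]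
  refine ⟨(comp_syzygyπ_eq_zero_iff K j _).2 (kernel.condition _), inferInstance,
    h.epi_of_lift _ hlift, fun k hk => ?_, hlift⟩
  exact ⟨kernel.lift _ k ((comp_syzygyπ_eq_zero_iff K j k).1 hk), kernel.lift_ι _ _ _⟩

/-- The map of a cochain complex onto the next object of cocycles. -/
noncomputable def toCocycles (K : CochainComplex C ℕ) (j : ℕ) :
    K.X j ⟶ kernel (K.d (j + 1) (j + 2)) :=
  kernel.lift _ (K.d j (j + 1)) (K.d_comp_d _ _ _)

theorem comp_toCocycles_eq_zero_iff (K : CochainComplex C ℕ) (j : ℕ) {W : C} (f : W ⟶ K.X j) :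
    f ≫ toCocycles K j = 0 ↔ f ≫ K.d j (j + 1) = 0 := by
  rw [← cancel_mono (kernel.ι (K.d (j + 1) (j + 2))), Category.assoc, toCocycles, kernel.lift_ι,
    zero_comp]

theorem exists_lift_toCocycles {K : CochainComplex C ℕ} {j : ℕ} (hK : XExactAt 𝒳 K (j + 1))
    (X : C) (hX : 𝒳 X) (f : X ⟶ kernel (K.d (j + 1) (j + 2))) :
    ∃ g : X ⟶ K.X j, g ≫ toCocycles K j = f := by
  obtain ⟨g, hg⟩ := (xExactAt_cochain_succ_iff K j).1 hK X hX (f ≫ kernel.ι _) (by simp)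
  refine ⟨g, ?_⟩
  rw [← cancel_mono (kernel.ι (K.d (j + 1) (j + 2))), Category.assoc, toCocycles, kernel.lift_ι, hg]

theorem IsAdmissibleBalancedPair.isConflation_cocycles (h : IsAdmissibleBalancedPair 𝒳 𝒴)
    (K : CochainComplex C ℕ) (j : ℕ) (hK : XExactAt 𝒳 K (j + 1)) :
    IsConflation 𝒳 (kernel.ι (K.d j (j + 1))) (toCocycles K j) := by
  have hlift := exists_lift_toCocycles hK
  refine ⟨(comp_toCocycles_eq_zero_iff K j _).2 (kernel.condition _), inferInstance,
    h.epi_of_lift _ hlift, fun k hk => ?_, hlift⟩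
  exact ⟨kernel.lift _ k ((comp_toCocycles_eq_zero_iff K j k).1 hk), kernel.lift_ι _ _ _⟩

theorem IsAdmissibleBalancedPair.isConflation_cochain_zero (h : IsAdmissibleBalancedPair 𝒳 𝒴)
    (K : CochainComplex C ℕ) (hK : XExact 𝒳 K) :
    IsConflation 𝒳 (K.d 0 1) (toCocycles K 1) :=
  h.isConflation_of_exact ((comp_toCocycles_eq_zero_iff K 1 _).2 (K.d_comp_d _ _ _))
    ((xExactAt_cochain_zero_iff K).1 (hK 0))
    (fun X hX f hf => (xExactAt_cochain_succ_iff K 0).1 (hK 1) X hX f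
      ((comp_toCocycles_eq_zero_iff K 1 f).1 hf))
    (exists_lift_toCocycles (hK 2))

end Syzygy

/-! ### Covers by 𝒳, embeddings into 𝒴, relative injectivity of 𝒴 -/

section Enough

namespace IsAdmissibleBalancedPair

variable (h : IsAdmissibleBalancedPair 𝒳 𝒴)

include h

/-- Every object is a quotient of an object of `𝒳`, with a kernel whose morphisms to `𝒴` extend. -/
theorem exists_conflation_left (A : C) : ∃ (K P : C) (i : K ⟶ P) (p : P ⟶ A),
    𝒳 P ∧ IsConflation 𝒳 i p ∧ ∀ Y, 𝒴 Y → ∀ f : K ⟶ Y, ∃ g : P ⟶ Y, i ≫ g = f := by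
  obtain ⟨R, hR⟩ := h.resolution A
  have hc := fun j => h.isConflation_syzygy R.augmented j (R.exact j)
  refine ⟨_, _, _, _, R.mem 0, hc 0, fun Y hY f => ?_⟩
  have hepi := (hc 1).epi
  obtain ⟨g, hg⟩ := (homInto_exactAt_succ_iff R.augmented Y 1).1 (hR Y hY 2)
    (syzygyπ R.augmented 1 ≫ f) (by
      rw [← syzygyπ_comp_ι, Category.assoc, reassoc_of% (hc 1).zero, zero_comp, comp_zero])
  refine ⟨g, ?_⟩
  rw [← syzygyπ_comp_ι, Category.assoc] at hg
  exact (cancel_epi _).1 hg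

/-- Every object embeds into an object of `𝒴`. -/
theorem exists_conflation_right (M : C) : ∃ (Y L : C) (i : M ⟶ Y) (p : Y ⟶ L),
    𝒴 Y ∧ IsConflation 𝒳 i p := by
  obtain ⟨Q, hQ⟩ := h.coresolution M
  exact ⟨_, _, _, _, Q.mem 0, h.isConflation_cochain_zero Q.augmented hQ⟩

/-- The objects of `𝒴` are injective relative to conflations. -/
theorem exists_extension {A B F : C} {i : A ⟶ B} {p : B ⟶ F} (hc : IsConflation 𝒳 i p)
    {Y : C} (hY : 𝒴 Y) (a : A ⟶ Y) : ∃ b : B ⟶ Y, i ≫ b = a := by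
  obtain ⟨K, P, j, q, hP, hq, hext⟩ := h.exists_conflation_left F
  have := hc.mono
  have := hq.epi
  obtain ⟨s, hs⟩ := hc.lift_of_mem P hP q
  obtain ⟨t, ht⟩ := hc.exists_lift (j ≫ s) (by rw [Category.assoc, hs, hq.zero])
  obtain ⟨g, hg⟩ := hext Y hY (t ≫ a)
  -- A ⊞ P covers B, and the kernel of this cover is K embedded by (-t, j). As g extends t ≫ a, the
  -- map (a, g) kills it and descends to B.
  have hepi : Epi (biprod.desc i s) := by
    refine Preadditive.epi_of_cancel_zero _ fun {W} f hf => ?_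
    have h1 : i ≫ f = 0 := by simpa using biprod.inl ≫= hf
    have h2 : s ≫ f = 0 := by simpa using biprod.inr ≫= hf
    obtain ⟨l, rfl⟩ := hc.exists_desc f h1
    rw [← Category.assoc, hs] at h2
    rw [zero_of_epi_comp q h2, comp_zero]
  have hdesc : ∀ {W : C} (k : W ⟶ A ⊞ P), k ≫ biprod.desc i s = 0 → k ≫ biprod.desc a g = 0 := by
    intro W k hk
    rw [biprod.desc_eq, Preadditive.comp_add, ← Category.assoc, ← Category.assoc] at hk ⊢
    obtain ⟨l, hl⟩ := hq.exists_lift (k ≫ biprod.snd) (by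
      have := hk =≫ p
      simpa [hc.zero, hs] using this)
    have hl' : k ≫ biprod.fst = -(l ≫ t) := by
      rw [← cancel_mono i, Preadditive.neg_comp, Category.assoc l, ht, ← Category.assoc l, hl]
      exact eq_neg_of_add_eq_zero_left hk
    rw [hl', ← hl, Category.assoc, hg]
    simp
  have hker := hdesc _ (kernel.condition (biprod.desc i s))
  refine ⟨Abelian.epiDesc _ _ hker, ?_⟩
  have := biprod.inl (X := A) (Y := P) ≫= Abelian.comp_epiDesc _ _ hker
  rwa [← Category.assoc, biprod.inl_desc, biprod.inl_desc] at this

end IsAdmissibleBalancedPair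

end Enough

/-! ### Vanishing of relative Ext as a lifting property -/

/-- Vanishing of `Ext^1_𝒳(A, M)`: morphisms from `A` lift along the deflations with kernel `M`. -/
def ExtOneVanish (𝒳 : ObjectProperty C) (A M : C) : Prop :=
  ∀ ⦃E F : C⦄ (i : M ⟶ E) (p : E ⟶ F), IsConflation 𝒳 i p → ∀ f : A ⟶ F, ∃ g : A ⟶ E, g ≫ p = f

/-- Vanishing of `Ext^{k+1}_𝒳(A, M)`, by recursion on the cosyzygies of `M` relative to `𝒴`. -/
def ExtVanish (𝒳 𝒴 : ObjectProperty C) : ℕ → C → C → Prop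
  | 0, A, M => ExtOneVanish 𝒳 A M
  | k + 1, A, M => ∀ ⦃Y L : C⦄ (i : M ⟶ Y) (p : Y ⟶ L), 𝒴 Y → IsConflation 𝒳 i p →
      ExtVanish 𝒳 𝒴 k A L

theorem extOneVanish_of_extension {K P A M : C} {j : K ⟶ P} {q : P ⟶ A} (hP : 𝒳 P)
    (hq : IsConflation 𝒳 j q) (H : ∀ f : K ⟶ M, ∃ g : P ⟶ M, j ≫ g = f) :
    ExtOneVanish 𝒳 A M := by
  intro E F i p hc f
  have := hc.mono
  have := hq.epi
  obtain ⟨s, hs⟩ := hc.lift_of_mem P hP (q ≫ f)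
  obtain ⟨t, ht⟩ := hc.exists_lift (j ≫ s) (by
    rw [Category.assoc, hs, reassoc_of% hq.zero, zero_comp])
  obtain ⟨g, hg⟩ := H t
  obtain ⟨l, hl⟩ := hq.exists_desc (s - g ≫ i) (by
    rw [Preadditive.comp_sub, ← Category.assoc, hg, ht, sub_self])
  refine ⟨l, ?_⟩
  rw [← cancel_epi q, ← Category.assoc, hl, Preadditive.sub_comp, Category.assoc, hc.zero, hs,
    comp_zero, sub_zero]

theorem ExtOneVanish.of_retract_left {A A' M : C} (H : ExtOneVanish 𝒳 A M) (s : A' ⟶ A)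
    (r : A ⟶ A') (hsr : s ≫ r = 𝟙 A') : ExtOneVanish 𝒳 A' M := by
  intro E F i p hc f
  obtain ⟨g, hg⟩ := H i p hc (r ≫ f)
  exact ⟨s ≫ g, by rw [Category.assoc, hg, reassoc_of% hsr]⟩

theorem ExtVanish.of_retract_left {k : ℕ} {A A' M : C} (H : ExtVanish 𝒳 𝒴 k A M) (s : A' ⟶ A)
    (r : A ⟶ A') (hsr : s ≫ r = 𝟙 A') : ExtVanish 𝒳 𝒴 k A' M := by
  induction k generalizing M with
  | zero => exact ExtOneVanish.of_retract_left H s r hsr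
  | succ k ih => exact fun Y L i p hY hc => ih (H i p hY hc)

theorem extVanish_of_isZero {A : C} (hA : IsZero A) (k : ℕ) (M : C) : ExtVanish 𝒳 𝒴 k A M := by
  induction k generalizing M with
  | zero => exact fun E F i p _ f => ⟨0, hA.eq_of_src _ _⟩
  | succ k ih => exact fun Y L i p _ _ => ih L

/-- Lifts are chosen on each summand and glued, so coproducts need not be exact. -/
theorem ExtVanish.coproduct {ι : Type*} {A : ι → C} [HasCoproduct A] {k : ℕ} {M : C}
    (H : ∀ a, ExtVanish 𝒳 𝒴 k (A a) M) : ExtVanish 𝒳 𝒴 k (∐ A) M := by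
  induction k generalizing M with
  | zero =>
    intro E F i p hc f
    choose g hg using fun a => H a i p hc (Sigma.ι A a ≫ f)
    exact ⟨Sigma.desc g, Sigma.hom_ext _ _ fun a => by simp [hg]⟩
  | succ k ih => exact fun Y L i p hY hc => ih fun a => H a i p hY hc

/-! ### Balance, dimension shifting and comparison with homology -/

namespace IsAdmissibleBalancedPair

variable (h : IsAdmissibleBalancedPair 𝒳 𝒴)

include h

/-- A single embedding of M into 𝒴 is enough to test. A map from a syzygy of A to M extends to P
after entering Y; correcting the extension by a lift of the induced A ⟶ L brings it back into M. -/
theorem extOneVanish_of_lift {A M Y L : C} {i : M ⟶ Y} {p : Y ⟶ L} (hY : 𝒴 Y)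
    (hc : IsConflation 𝒳 i p) (H : ∀ f : A ⟶ L, ∃ g : A ⟶ Y, g ≫ p = f) :
    ExtOneVanish 𝒳 A M := by
  obtain ⟨K, P, j, q, hP, hq, -⟩ := h.exists_conflation_left A
  have := hc.mono
  refine extOneVanish_of_extension hP hq fun f => ?_
  obtain ⟨b, hb⟩ := h.exists_extension hq hY (f ≫ i)
  obtain ⟨a, ha⟩ := hq.exists_desc (b ≫ p) (by
    rw [← Category.assoc, hb, Category.assoc, hc.zero, comp_zero])
  obtain ⟨g, hg⟩ := H a
  obtain ⟨l, hl⟩ := hc.exists_lift (b - q ≫ g) (by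
    rw [Preadditive.sub_comp, Category.assoc, hg, ha, sub_self])
  refine ⟨l, ?_⟩
  rw [← cancel_mono i, Category.assoc, hl, Preadditive.comp_sub, hb, reassoc_of% hq.zero,
    zero_comp, sub_zero]

/-- If `Ext^1_𝒳(A, M)` vanishes, then morphisms to `M` extend along inflations with
cokernel `A`. -/
theorem exists_extension_of_extOneVanish {A M K B : C} (H : ExtOneVanish 𝒳 A M) {j : K ⟶ B}
    {q : B ⟶ A} (hq : IsConflation 𝒳 j q) (f : K ⟶ M) : ∃ g : B ⟶ M, j ≫ g = f := by
  obtain ⟨Y, L, i, p, hY, hc⟩ := h.exists_conflation_right M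
  have := hc.mono
  obtain ⟨b, hb⟩ := h.exists_extension hq hY (f ≫ i)
  obtain ⟨a, ha⟩ := hq.exists_desc (b ≫ p) (by
    rw [← Category.assoc, hb, Category.assoc, hc.zero, comp_zero])
  obtain ⟨g, hg⟩ := H i p hc a
  obtain ⟨l, hl⟩ := hc.exists_lift (b - q ≫ g) (by
    rw [Preadditive.sub_comp, Category.assoc, hg, ha, sub_self])
  refine ⟨l, ?_⟩
  rw [← cancel_mono i, Category.assoc, hl, Preadditive.comp_sub, hb, reassoc_of% hq.zero,
    zero_comp, sub_zero]

/-- Balance in the lowest degree: syzygies of `A` and cosyzygies of `M` give the same condition. -/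
theorem extOneVanish_syzygy_iff_cosyzygy {K P A M Y L : C} {j : K ⟶ P} {q : P ⟶ A} {i : M ⟶ Y}
    {p : Y ⟶ L} (hP : 𝒳 P) (hY : 𝒴 Y) (hq : IsConflation 𝒳 j q) (hc : IsConflation 𝒳 i p) :
    ExtOneVanish 𝒳 K M ↔ ExtOneVanish 𝒳 A L := by
  refine ⟨fun H => extOneVanish_of_extension hP hq fun f => ?_,
    fun H => h.extOneVanish_of_lift hY hc fun f => ?_⟩
  · obtain ⟨g, hg⟩ := H i p hc f
    obtain ⟨b, hb⟩ := h.exists_extension hq hY g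
    exact ⟨b ≫ p, by rw [← Category.assoc, hb, hg]⟩
  · obtain ⟨g, hg⟩ := h.exists_extension_of_extOneVanish H hq f
    obtain ⟨b, hb⟩ := hc.lift_of_mem P hP g
    exact ⟨j ≫ b, by rw [Category.assoc, hb, hg]⟩

/-- Dimension shifting along a syzygy. -/
theorem extVanish_succ_iff {K P A M : C} {j : K ⟶ P} {q : P ⟶ A} (hP : 𝒳 P)
    (hq : IsConflation 𝒳 j q) (k : ℕ) :
    ExtVanish 𝒳 𝒴 (k + 1) A M ↔ ExtVanish 𝒳 𝒴 k K M := by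
  induction k generalizing M with
  | zero =>
    refine ⟨fun H => ?_, fun H Y L i p hY hc =>
      (h.extOneVanish_syzygy_iff_cosyzygy hP hY hq hc).1 H⟩
    obtain ⟨Y, L, i, p, hY, hc⟩ := h.exists_conflation_right M
    exact (h.extOneVanish_syzygy_iff_cosyzygy hP hY hq hc).2 (H i p hY hc)
  | succ k ih =>
    exact ⟨fun H Y L i p hY hc => ih.1 (H i p hY hc), fun H Y L i p hY hc => ih.2 (H i p hY hc)⟩

/-- The definition recurses on M, which would require comparing cosyzygies of M and M'. Dimension
shifting moves the recursion to A and keeps the retract fixed. -/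
theorem extVanish_of_retract_right {k : ℕ} {A M M' : C} (H : ExtVanish 𝒳 𝒴 k A M) (s : M' ⟶ M)
    (r : M ⟶ M') (hsr : s ≫ r = 𝟙 M') : ExtVanish 𝒳 𝒴 k A M' := by
  induction k generalizing A with
  | zero =>
    obtain ⟨K, P, j, q, hP, hq, -⟩ := h.exists_conflation_left A
    refine extOneVanish_of_extension hP hq fun f => ?_
    obtain ⟨g, hg⟩ := h.exists_extension_of_extOneVanish H hq (f ≫ s)
    exact ⟨g ≫ r, by rw [← Category.assoc, hg, Category.assoc, hsr, Category.comp_id]⟩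
  | succ k ih =>
    obtain ⟨K, P, j, q, hP, hq, -⟩ := h.exists_conflation_left A
    exact (h.extVanish_succ_iff hP hq k).2 (ih ((h.extVanish_succ_iff hP hq k).1 H))

/-- Exactness of `Ext^k(A, M) ⟶ Ext^k(A', M) ⟶ Ext^{k+1}(A'', M)`. -/
theorem extVanish_sub {A' A A'' M : C} {i : A' ⟶ A} {p : A ⟶ A''} (hc : IsConflation 𝒳 i p)
    {k : ℕ} (H : ExtVanish 𝒳 𝒴 k A M) (H'' : ExtVanish 𝒳 𝒴 (k + 1) A'' M) :
    ExtVanish 𝒳 𝒴 k A' M := by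
  induction k generalizing M with
  | zero =>
    obtain ⟨Y, L, j, q, hY, hq⟩ := h.exists_conflation_right M
    refine h.extOneVanish_of_lift hY hq fun f => ?_
    -- The cosyzygy L absorbs one degree of the hypothesis on A'': f extends to A, where it lifts to
    -- Y.
    obtain ⟨g, hg⟩ := h.exists_extension_of_extOneVanish (H'' j q hY hq) hc f
    obtain ⟨b, hb⟩ := H j q hq g
    exact ⟨i ≫ b, by rw [Category.assoc, hb, hg]⟩
  | succ k ih => exact fun Y L j q hY hq => ih (H j q hY hq) (H'' j q hY hq)

/-- Exactness of `Hom(A, B) ⟶ Hom(A, F) ⟶ Ext^1(A, K) ⟶ Ext^1(A, B)`. -/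
theorem extOneVanish_kernel {A K B F : C} {i : K ⟶ B} {p : B ⟶ F} (hc : IsConflation 𝒳 i p)
    (H : ExtOneVanish 𝒳 A B) (hlift : ∀ f : A ⟶ F, ∃ g : A ⟶ B, g ≫ p = f) :
    ExtOneVanish 𝒳 A K := by
  obtain ⟨R, P, j, q, hP, hq, -⟩ := h.exists_conflation_left A
  have := hc.mono
  refine extOneVanish_of_extension hP hq fun f => ?_
  obtain ⟨b, hb⟩ := h.exists_extension_of_extOneVanish H hq (f ≫ i)
  obtain ⟨a, ha⟩ := hq.exists_desc (b ≫ p) (by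
    rw [← Category.assoc, hb, Category.assoc, hc.zero, comp_zero])
  obtain ⟨g, hg⟩ := hlift a
  obtain ⟨l, hl⟩ := hc.exists_lift (b - q ≫ g) (by
    rw [Preadditive.sub_comp, Category.assoc, hg, ha, sub_self])
  refine ⟨l, ?_⟩
  rw [← cancel_mono i, Category.assoc, hl, Preadditive.comp_sub, hb, reassoc_of% hq.zero,
    zero_comp, sub_zero]

/-- Exactness of `Ext^k(A, F) ⟶ Ext^{k+1}(A, K) ⟶ Ext^{k+1}(A, B)`. -/
theorem extVanish_kernel {A K B F : C} {i : K ⟶ B} {p : B ⟶ F} (hc : IsConflation 𝒳 i p)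
    {k : ℕ} (HB : ExtVanish 𝒳 𝒴 (k + 1) A B) (HF : ExtVanish 𝒳 𝒴 k A F) :
    ExtVanish 𝒳 𝒴 (k + 1) A K := by
  induction k generalizing A with
  | zero =>
    obtain ⟨R, P, j, q, hP, hq, -⟩ := h.exists_conflation_left A
    refine (h.extVanish_succ_iff hP hq 0).2
      (h.extOneVanish_kernel hc ((h.extVanish_succ_iff hP hq 0).1 HB) fun f => ?_)
    obtain ⟨g, hg⟩ := h.exists_extension_of_extOneVanish HF hq f
    obtain ⟨b, hb⟩ := hc.lift_of_mem P hP g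
    exact ⟨j ≫ b, by rw [Category.assoc, hb, hg]⟩
  | succ k ih =>
    obtain ⟨R, P, j, q, hP, hq, -⟩ := h.exists_conflation_left A
    exact (h.extVanish_succ_iff hP hq _).2
      (ih ((h.extVanish_succ_iff hP hq _).1 HB) ((h.extVanish_succ_iff hP hq _).1 HF))

/-- Exactness of `Ext^k(A, B) ⟶ Ext^k(A, F) ⟶ Ext^{k+1}(A, K)`. -/
theorem extVanish_quotient {A K B F : C} {i : K ⟶ B} {p : B ⟶ F} (hc : IsConflation 𝒳 i p)
    {k : ℕ} (HB : ExtVanish 𝒳 𝒴 k A B) (HK : ExtVanish 𝒳 𝒴 (k + 1) A K) :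
    ExtVanish 𝒳 𝒴 k A F := by
  induction k generalizing A with
  | zero =>
    obtain ⟨R, P, j, q, hP, hq, -⟩ := h.exists_conflation_left A
    refine extOneVanish_of_extension hP hq fun f => ?_
    obtain ⟨g, hg⟩ := (h.extVanish_succ_iff hP hq 0).1 HK i p hc f
    obtain ⟨b, hb⟩ := h.exists_extension_of_extOneVanish HB hq g
    exact ⟨b ≫ p, by rw [← Category.assoc, hb, hg]⟩
  | succ k ih =>
    obtain ⟨R, P, j, q, hP, hq, -⟩ := h.exists_conflation_left A
    exact (h.extVanish_succ_iff hP hq _).2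
      (ih ((h.extVanish_succ_iff hP hq _).1 HB) ((h.extVanish_succ_iff hP hq _).1 HK))

/-- `Ext` vanishing in terms of the syzygies of a resolution. -/
theorem extVanish_iff_syzygy {A M : C} (R : LeftResolution 𝒳 A) (k : ℕ) :
    ExtVanish 𝒳 𝒴 k A M ↔ ExtOneVanish 𝒳 (syzygy R.augmented k) M := by
  have aux : ∀ k m, ExtVanish 𝒳 𝒴 (k + m) A M ↔ ExtVanish 𝒳 𝒴 k (syzygy R.augmented m) M := by
    intro k m
    induction m generalizing k with
    | zero => rfl
    | succ m ih =>
      rw [← h.extVanish_succ_iff (R.mem m) (h.isConflation_syzygy R.augmented m (R.exact m)),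
        ← ih, Nat.add_right_comm, Nat.add_assoc]
  have := aux 0 k
  rwa [Nat.zero_add] at this

/-- Cocycles in degree k + 1 are maps from the (k + 1)-st syzygy to M, and coboundaries are those
that extend to the k-th term of R. This is Ext^1 vanishing on the k-th syzygy. -/
theorem homInto_exactAt_iff_extVanish {A M : C} (R : LeftResolution 𝒳 A) (k : ℕ) :
    (homInto R.complex M).ExactAt (k + 1) ↔ ExtVanish 𝒳 𝒴 k A M := by
  have hc := h.isConflation_syzygy R.augmented k (R.exact k)
  have hc' := h.isConflation_syzygy R.augmented (k + 1) (R.exact (k + 1))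
  have := hc'.epi
  have := (h.isConflation_syzygy R.augmented (k + 2) (R.exact (k + 2))).epi
  have haug : (homInto R.complex M).ExactAt (k + 1) ↔ (homInto R.augmented M).ExactAt (k + 2) :=
    (homInto_exactAt_succ_iff R.complex M k).trans
      (homInto_exactAt_succ_iff R.augmented M (k + 1)).symm
  rw [haug, h.extVanish_iff_syzygy R, homInto_exactAt_succ_iff, ← syzygyπ_comp_ι,
    ← syzygyπ_comp_ι]
  constructor
  · refine fun H => extOneVanish_of_extension (R.mem k) hc fun f => ?_
    obtain ⟨g, hg⟩ := H (syzygyπ R.augmented (k + 1) ≫ f) (by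
      rw [Category.assoc, reassoc_of% hc'.zero, zero_comp, comp_zero])
    refine ⟨g, ?_⟩
    rw [Category.assoc] at hg
    exact (cancel_epi _).1 hg
  · intro H f hf
    rw [Category.assoc] at hf
    obtain ⟨l, hl⟩ := hc'.exists_desc f (zero_of_epi_comp _ hf)
    obtain ⟨g, hg⟩ := h.exists_extension_of_extOneVanish H hc l
    exact ⟨g, by rw [Category.assoc, hg, hl]⟩

/-- The right side mentions no resolution, so vanishing is independent of the chosen one. -/
theorem isZero_relExt_iff (A M : C) (k : ℕ) :
    IsZero (relExt h.toIsBalancedPair A M (k + 1)) ↔ ExtVanish 𝒳 𝒴 k A M := by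
  rw [← h.homInto_exactAt_iff_extVanish (h.toIsBalancedPair.chosenResolution A) k,
    HomologicalComplex.exactAt_iff_isZero_homology]
  rfl

theorem rightPerp_iff (T M : C) :
    rightPerp h.toIsBalancedPair T M ↔ ∀ k, ExtVanish 𝒳 𝒴 k T M := by
  refine ⟨fun H k => (h.isZero_relExt_iff T M k).1 (H (k + 1) (by omega)), fun H i hi => ?_⟩
  obtain ⟨k, rfl⟩ : ∃ k, i = k + 1 := ⟨i - 1, by omega⟩
  exact (h.isZero_relExt_iff T M k).2 (H k)

theorem extVanish_of_xDimLE {A : C} {n : ℕ} (hA : XDimLE 𝒳 A n) {k : ℕ} (hk : n ≤ k) (M : C) :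
    ExtVanish 𝒳 𝒴 k A M := by
  obtain ⟨R, hR⟩ := hA
  rw [h.extVanish_iff_syzygy R]
  have hc := h.isConflation_syzygy R.augmented k (R.exact k)
  have hc' := h.isConflation_syzygy R.augmented (k + 1) (R.exact (k + 1))
  have := hc'.epi
  -- This syzygy is a quotient of the resolution term in degree k + 1 > n, which is zero.
  have hz : IsZero (syzygy R.augmented (k + 1)) :=
    IsZero.of_epi (syzygyπ R.augmented (k + 1)) (hR (k + 1) (by omega))
  exact extOneVanish_of_extension (R.mem k) hc fun f => ⟨0, hz.eq_of_src _ _⟩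

end IsAdmissibleBalancedPair

/-! ### Splicing conflations -/

section Splice

variable (A B : ℕ → C) (i : ∀ j, A (j + 1) ⟶ B j) (p : ∀ j, B j ⟶ A j)
  (w : ∀ j, i j ≫ p j = 0)

/-- The chain complex obtained by splicing sequences `A (j + 1) ⟶ B j ⟶ A j`. -/
noncomputable def splice : ChainComplex C ℕ :=
  ChainComplex.of B (fun j => p (j + 1) ≫ i j) fun j => by
    rw [Category.assoc, reassoc_of% w (j + 1), zero_comp, comp_zero]

theorem splice_d (j : ℕ) : (splice A B i p w).d (j + 1) j = p (j + 1) ≫ i j :=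
  ChainComplex.of_d B (fun j => p (j + 1) ≫ i j) j

theorem splice_d_comp : (splice A B i p w).d 1 0 ≫ p 0 = 0 :=
  (congrArg (· ≫ p 0) (splice_d A B i p w 0)).trans
    ((Category.assoc (p 1) (i 0) (p 0)).trans ((congrArg _ (w 0)).trans comp_zero))

theorem xExact_augment_splice (hc : ∀ j, IsConflation 𝒳 (i j) (p j)) :
    XExact 𝒳 ((splice A B i p w).augment (p 0) (splice_d_comp A B i p w)) := by
  rintro (_ | _ | j)
  · exact (xExactAt_chain_zero_iff _).2 (hc 0).lift_of_mem
  · refine (xExactAt_chain_succ_iff _ 0).2 fun X hX (f : X ⟶ B 0) (hf : f ≫ p 0 = 0) => ?_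
    obtain ⟨l, hl⟩ := (hc 0).exists_lift f hf
    obtain ⟨g, hg⟩ := (hc 1).lift_of_mem X hX l
    refine ⟨g, ?_⟩
    change g ≫ (splice A B i p w).d 1 0 = f
    rw [splice_d, ← hl, ← hg]
    exact (Category.assoc _ _ _).symm
  · refine (xExactAt_chain_succ_iff _ (j + 1)).2 fun X hX (f : X ⟶ B (j + 1))
      (hf : f ≫ (splice A B i p w).d (j + 1) j = 0) => ?_
    have := (hc j).mono
    have hf' : (f ≫ p (j + 1)) ≫ i j = 0 := by
      rw [splice_d] at hf
      exact (Category.assoc _ _ _).trans hf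
    obtain ⟨l, hl⟩ := (hc (j + 1)).exists_lift f (zero_of_comp_mono _ hf')
    obtain ⟨g, hg⟩ := (hc (j + 2)).lift_of_mem X hX l
    refine ⟨g, ?_⟩
    change g ≫ (splice A B i p w).d (j + 2) (j + 1) = f
    rw [splice_d, ← hl, ← hg]
    exact (Category.assoc _ _ _).symm

theorem nonempty_iso_image_augment_splice (hc : ∀ j, IsConflation 𝒳 (i j) (p j)) (j : ℕ) :
    Nonempty (image (((splice A B i p w).augment (p 0) (splice_d_comp A B i p w)).d (j + 1) j)
      ≅ A j) := by
  have := (hc j).epi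
  have := strongEpi_of_epi (p j)
  cases j with
  | zero =>
    exact ⟨(image.isoStrongEpiMono (p 0) (𝟙 (A 0)) (Category.comp_id _)).symm⟩
  | succ j =>
    have := (hc j).mono
    exact ⟨(image.isoStrongEpiMono (p (j + 1)) (i j) (splice_d A B i p w j).symm).symm⟩

end Splice

/-! ### Add T and the three implications -/

section Add

variable (T : C) [∀ I : Type v, HasCoproduct fun _ : I => T]

theorem addClosure_copower (I : Type v) : addClosure T (copower T I) :=
  ⟨_, I, ⟨(isoBiprodZero (isZero_zero C)).symm⟩⟩

theorem addClosure_exists_retract {A : C} (hA : addClosure T A) :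
    ∃ (I : Type v) (s : A ⟶ copower T I) (r : copower T I ⟶ A), s ≫ r = 𝟙 A := by
  obtain ⟨J, I, ⟨e⟩⟩ := hA
  exact ⟨I, biprod.inl ≫ e.hom, e.inv ≫ biprod.fst, by simp⟩

theorem extVanish_of_addClosure_left {A : C} (hA : addClosure T A) {k : ℕ} {M : C}
    (H : ExtVanish 𝒳 𝒴 k T M) : ExtVanish 𝒳 𝒴 k A M := by
  obtain ⟨I, s, r, hsr⟩ := addClosure_exists_retract T hA
  exact ExtVanish.of_retract_left (ExtVanish.coproduct fun _ => H) s r hsr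

theorem exists_lift_evaluation_of_addClosure {A M : C} (hA : addClosure T A) (f : A ⟶ M) :
    ∃ g : A ⟶ copower T (T ⟶ M), g ≫ evaluation T M = f := by
  obtain ⟨I, s, r, hsr⟩ := addClosure_exists_retract T hA
  obtain ⟨g, hg⟩ := exists_lift_evaluation_of_copower T (r ≫ f)
  exact ⟨s ≫ g, by rw [Category.assoc, hg, reassoc_of% hsr]⟩

variable {T}

namespace IsAdmissibleBalancedPair

variable (h : IsAdmissibleBalancedPair 𝒳 𝒴) {n : ℕ} (hT : IsTilting T h.toIsBalancedPair n)

include hT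

theorem extVanish_of_addClosure_right {A : C} (hA : addClosure T A) (k : ℕ) :
    ExtVanish 𝒳 𝒴 k T A := by
  obtain ⟨I, s, r, hsr⟩ := addClosure_exists_retract T hA
  exact h.extVanish_of_retract_right
    ((h.isZero_relExt_iff _ _ _).1 (hT.selfOrthogonal I (k + 1) (Nat.succ_pos k))) s r hsr

/-- Every object of `𝒳` embeds into an object of `Add T` with a cokernel that is
left orthogonal to `T^{𝒳⊥}`. -/
theorem exists_conflation_addClosure {X : C} (hX : 𝒳 X) : ∃ (A L : C) (i : X ⟶ A) (p : A ⟶ L),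
    addClosure T A ∧ IsConflation 𝒳 i p ∧
      ∀ M, (∀ k, ExtVanish 𝒳 𝒴 k T M) → ExtOneVanish 𝒳 L M := by
  obtain ⟨Q, η, w, hmem, hzero, hex⟩ := hT.coresolution X hX
  refine ⟨_, _, _, _, hmem 0 (Nat.zero_le n),
    h.isConflation_cochain_zero (Q.augment η w) hex, fun M hM => ?_⟩
  have hQ : ∀ i k, ExtVanish 𝒳 𝒴 k (Q.X i) M := fun i k => by
    rcases le_or_gt i n with hi | hi
    · exact extVanish_of_addClosure_left T (hmem i hi) (hM k)
    · exact extVanish_of_isZero (hzero i hi) k M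
  -- Descending induction on the cocycles Z_j inside `Q.X j`, along Z_j ⟶ Q_j ⟶ Z_{j+1}, starting
  -- from Z_j = 0 for j > n. The cokernel of the embedding of X is Z_1.
  have aux : ∀ m j, n < j + m → ∀ k, ExtVanish 𝒳 𝒴 k
      (kernel ((Q.augment η w).d (j + 1) (j + 2))) M := by
    intro m
    induction m with
    | zero =>
      exact fun j hj k => extVanish_of_isZero
        (IsZero.of_mono (kernel.ι ((Q.augment η w).d (j + 1) (j + 2))) (hzero j (by omega))) k M
    | succ m ih =>
      exact fun j hj k => h.extVanish_sub
        (h.isConflation_cocycles (Q.augment η w) (j + 1) (hex (j + 2))) (hQ j k)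
        (ih (j + 1) (by omega) (k + 1))
  exact aux n 1 (by omega) 0

theorem isConflation_evaluation {M : C} (hM : ∀ k, ExtVanish 𝒳 𝒴 k T M) :
    IsConflation 𝒳 (kernel.ι (evaluation T M)) (evaluation T M) := by
  refine h.isConflation_kernel _ fun X hX f => ?_
  obtain ⟨A, L, i, p, hA, hc, hL⟩ := h.exists_conflation_addClosure hT hX
  obtain ⟨g, hg⟩ := h.exists_extension_of_extOneVanish (hL M hM) hc f
  obtain ⟨l, hl⟩ := exists_lift_evaluation_of_addClosure T hA g
  exact ⟨i ≫ l, by rw [Category.assoc, hl, hg]⟩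

theorem extVanish_kernel_evaluation {M : C} (hM : ∀ k, ExtVanish 𝒳 𝒴 k T M) (k : ℕ) :
    ExtVanish 𝒳 𝒴 k T (kernel (evaluation T M)) := by
  have hc := h.isConflation_evaluation hT hM
  have hA := h.extVanish_of_addClosure_right hT (addClosure_copower T (T ⟶ M))
  cases k with
  | zero => exact h.extOneVanish_kernel hc (hA 0) (exists_lift_evaluation T)
  | succ k => exact h.extVanish_kernel hc (hA _) (hM k)

theorem leftClass_of_rightPerp {M : C} (hM : rightPerp h.toIsBalancedPair T M) :
    leftClass T h.toIsBalancedPair M := by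
  rw [h.rightPerp_iff] at hM
  -- Orthogonality travels with the iterated kernels; it is what makes each next evaluation a
  -- deflation.
  let N : ℕ → {N : C // ∀ k, ExtVanish 𝒳 𝒴 k T N} := fun j =>
    Nat.rec ⟨M, hM⟩ (fun _ N => ⟨kernel (evaluation T N.1), h.extVanish_kernel_evaluation hT N.2⟩) j
  have hc : ∀ j, IsConflation 𝒳 (kernel.ι (evaluation T (N j).1)) (evaluation T (N j).1) :=
    fun j => h.isConflation_evaluation hT (N j).2
  refine ⟨splice (fun j => (N j).1) (fun j => copower T (T ⟶ (N j).1))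
    (fun j => kernel.ι (evaluation T (N j).1)) (fun j => evaluation T (N j).1)
    (fun j => (hc j).zero), evaluation T (N 0).1, splice_d_comp _ _ _ _ _,
    fun j => addClosure_copower T _, xExact_augment_splice _ _ _ _ _ hc, fun j => ?_⟩
  obtain ⟨e⟩ := nonempty_iso_image_augment_splice (fun j => (N j).1) _ _ _
    (fun j => (hc j).zero) hc j
  rw [h.rightPerp_iff]
  exact fun k => h.extVanish_of_retract_right ((N j).2 k) e.hom e.inv e.hom_inv_id

theorem rightPerp_of_pres {L : C} (hL : Pres T 𝒳 n L) : rightPerp h.toIsBalancedPair T L := by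
  obtain ⟨P, ε, w, hmem, hex⟩ := hL
  rw [h.rightPerp_iff]
  -- The bound j ≤ k suffices: at j = n it puts Ext^{k+1} above the 𝒳-dimension of T, and each step
  -- raises j and k together.
  have aux : ∀ m j, j + m = n → ∀ k, j ≤ k → ExtVanish 𝒳 𝒴 k T (syzygy (P.augment ε w) j) := by
    intro m
    induction m with
    | zero => exact fun j hj k hk => h.extVanish_of_xDimLE hT.dim_le (by omega) _
    | succ m ih =>
      exact fun j hj k hk => h.extVanish_quotient
        (h.isConflation_syzygy (P.augment ε w) j (hex j (by omega)))
        (h.extVanish_of_addClosure_right hT (hmem j (by omega)) k)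
        (ih (j + 1) (by omega) (k + 1) (by omega))
  exact fun k => aux n 0 (Nat.zero_add n) k (Nat.zero_le k)

end IsAdmissibleBalancedPair

theorem pres_of_leftClass {h : IsBalancedPair 𝒳 𝒴} {M : C} (hM : leftClass T h M) (n : ℕ) :
    Pres T 𝒳 n M := by
  obtain ⟨P, ε, w, hmem, hex, -⟩ := hM
  exact ⟨P, ε, w, fun i _ => hmem i, fun i _ => hex i⟩

end Add

end RelativeTilting

theorem proposition3p7 {C : Type u} [Category.{v} C] [Abelian C]
    (𝒳 𝒴 : ObjectProperty C) (h : RelativeTilting.IsAdmissibleBalancedPair 𝒳 𝒴)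
    (n : ℕ) (T : C) [∀ I : Type v, HasCoproduct fun _ : I => T]
    (hT : RelativeTilting.IsTilting T h.toIsBalancedPair n) (U : C) :
    List.TFAE [
      RelativeTilting.rightPerp h.toIsBalancedPair T U,
      RelativeTilting.leftClass T h.toIsBalancedPair U,
      RelativeTilting.Pres T 𝒳 n U] := by
  tfae_have 1 → 2 := h.leftClass_of_rightPerp hT
  tfae_have 2 → 3 := fun hU => RelativeTilting.pres_of_leftClass hU n
  tfae_have 3 → 1 := h.rightPerp_of_pres hT
  tfae_finish
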